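/- Let $(\Omega,\mathcal F,\mathbb P)$ be a probability space with a metric dynamical system $\theta=(\theta_t)_{t\in\mathbb R}$, i.e. $\theta_0=\mathrm{id}$, $\theta_t\circ\theta_s=\theta_{t+s}$, $(t,\omega)\mapsto\theta_t\omega$ is jointly measurable, and every $\theta_t$ preserves $\mathbb P$. Let $N\ge 1$ and let $q_1,\dots,q_{2N-2}:\Omega\to\mathbb R$ be $\mathcal F$-measurable with $$0<c_*\le q_i(\omega)\le C_*<\infty\qquad\text{for all } i \text{ and all }\omega\in\Omega .$$ Let $Q(\omega)$ be the tridiagonal $N\times N$ matrix with entries $Q_{j+1,j}=q_{2j-1}$ and $Q_{j,j+1}=q_{2j}$ ($1\le j\le N-1$) and with the diagonal entries that make all column sums zero (for $N=1$, $Q=0$). Then for all $\omega\in\Omega$ and $p_0\in\mathbb R^N$ the equation $$\frac{dp}{dt}=Q(\theta_t\omega)\,p,\qquad p(0)=p_0,$$ has a unique solution $p(t;\omega,p_0)$, $t\ge 0$ (absolutely continuous on bounded intervals, equation satisfied for almost every $t$), and the following holds. Let $\Sigma_N$ be the simplex of probability vectors in $\mathbb R^N$ and $\mathring\Sigma_N$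 the set of those with all components positive. The maps $p(t;\omega,\cdot)$ map $\Sigma_N$ into itself and $\mathring\Sigma_N$ into itself, and their restriction to $\Sigma_N$ is a cocycle $\varphi$: $\varphi(0,\omega,\cdot)=\mathrm{id}$ and $\varphi(t+s,\omega,x)=\varphi(s,\theta_t\omega,\varphi(t,\omega,x))$. Let $$\rho_H(x,y)=\ln\Bigl(\max_i\frac{y_i}{x_i}\cdot\max_i\frac{x_i}{y_i}\Bigr)$$ be the Hilbert projective metric, where the maxima are over the common support if $x,y\in\Sigma_N$ have the same zero components, and $\rho_H(x,y)=\infty$ otherwise; it is a finite metric on $\mathring\Sigma_N$. With respect to $\rho_H$ the cocycle is * uniformly dissipative: there are $T_d\ge0$ and a $\rho_H$-closed set $M_0\subseteq\Sigma_N$ of finite $\rho_H$-diameter with $\varphi(T_d,\omega,\Sigma_N)\subseteq M_0$ for all $\omega\in\Omega$; * uniformly contractive: there are $T_c\ge0$ and $\lambda\in[0,1)$ with $\rho_H(\varphi(T_c,\omega,x),\varphi(T_c,\omega,y))\le\lambda\,\rho_H(x,y)$ for all $\omega\in\Omega$ and $x,y\in\Sigma_N$. Moreover, there are points $a(\omega)\in\mathring\Sigma_N$,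 $\omega\in\Omega$, such that the family of singletons $A(\omega)=\{a(\omega)\}$ is a random attractor of $\varphi$, both for the metric of a norm on $\mathbb R^N$ and for $\rho_H$. That is, for each of these two metrics: $\omega\mapsto A(\omega)$ is $\mathcal F$-measurable, $\varphi(t,\omega,A(\omega))=A(\theta_t\omega)$ for all $t\ge0$ and $\omega\in\Omega$, and for every $\mathcal F$-measurable family $\{D(\omega)\}_{\omega\in\Omega}$ of nonempty compact subsets of $\Sigma_N$ and every $\omega\in\Omega$, $$\operatorname{dist}\bigl(\varphi(t,\theta_{-t}\omega,D(\theta_{-t}\omega)),A(\omega)\bigr)\to0\quad\text{as } t\to\infty,$$ where $\operatorname{dist}(B,A)=\sup_{x\in B}\inf_{y\in A}d(x,y)$ for the metric $d$ in question, and a family of sets is called $\mathcal F$-measurable if the set of $\omega$ at which it meets $U$ is in $\mathcal F$ for every open $U\subseteq\Sigma_N$. Finally, the attractor is asymptotically stable: $$\|p(t;\omega,p_0)-a(\theta_t\omega)\|\to0\quad\text{as } t\to\infty\qquad\text{for all } p_0\in\mathring\Sigma_N,\ \omega\in\Omega .$$ -/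

import Mathlib

open MeasureTheory Filter Topology Set
open scoped NNReal ENNReal Matrix

namespace RandomMarkov

/-! ### Driving systems and cocycles -/

/-- A metric dynamical system on the probability space `(Ω, P)`. -/
structure IsMetricDynamicalSystem {Ω : Type*} [MeasurableSpace Ω] (P : Measure Ω)
    (θ : ℝ → Ω → Ω) : Prop where
  zero : θ 0 = id
  comp : ∀ t s : ℝ, θ t ∘ θ s = θ (t + s)
  measurable : Measurable fun z : ℝ × Ω => θ z.1 z.2
  preserving : ∀ t : ℝ, MeasurePreserving (θ t) P P

/-- A cocycle on `M` over the driving system `θ`, with time set `[0, ∞)`. -/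
structure IsCocycle {Ω M : Type*} (θ : ℝ → Ω → Ω) (φ : ℝ≥0 → Ω → M → M) : Prop where
  zero : ∀ (ω : Ω) (x : M), φ 0 ω x = x
  add : ∀ (t s : ℝ≥0) (ω : Ω) (x : M), φ (t + s) ω x = φ s (θ t ω) (φ t ω x)

/-- Uniform dissipativity: at some time the whole space is mapped, for all `ω`, into one closed
bounded set (bounded means of finite diameter). -/
def UniformlyDissipative {Ω M : Type*} [EMetricSpace M] (φ : ℝ≥0 → Ω → M → M) : Prop :=
  ∃ (Td : ℝ≥0) (M₀ : Set M), IsClosed M₀ ∧ Metric.ediam M₀ ≠ ⊤ ∧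
    ∀ ω : Ω, φ Td ω '' univ ⊆ M₀

/-- Uniform contractivity. -/
def UniformlyContractive {Ω M : Type*} [EMetricSpace M] (φ : ℝ≥0 → Ω → M → M) : Prop :=
  ∃ (Tc lam : ℝ≥0), lam < 1 ∧
    ∀ (ω : Ω) (x y : M), edist (φ Tc ω x) (φ Tc ω y) ≤ lam * edist x y

/-- Measurability of a set-valued map: the hitting set of every open set is measurable. -/
def MeasurableSetFamily {Ω M : Type*} [MeasurableSpace Ω] [TopologicalSpace M]
    (A : Ω → Set M) : Prop :=
  ∀ U : Set M, IsOpen U → MeasurableSet {ω | (A ω ∩ U).Nonempty}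

/-- A random attractor: a measurable invariant family of nonempty compact sets that pullback
attracts all measurable families of nonempty compact sets, in the Hausdorff semi-distance
`dist (B, A) = sup_{x ∈ B} inf_{y ∈ A} d (x, y)`. -/
structure IsRandomAttractor {Ω M : Type*} [MeasurableSpace Ω] [EMetricSpace M]
    (θ : ℝ → Ω → Ω) (φ : ℝ≥0 → Ω → M → M) (A : Ω → Set M) : Prop where
  nonempty : ∀ ω, (A ω).Nonempty
  isCompact : ∀ ω, IsCompact (A ω)
  measurable : MeasurableSetFamily A
  invariant : ∀ (t : ℝ≥0) (ω : Ω), φ t ω '' A ω = A (θ t ω)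
  attracts : ∀ D : Ω → Set M, MeasurableSetFamily D → (∀ ω, (D ω).Nonempty) →
    (∀ ω, IsCompact (D ω)) → ∀ ω : Ω,
      Tendsto (fun t : ℝ≥0 => ⨆ x ∈ φ t (θ (-(t : ℝ)) ω) '' D (θ (-(t : ℝ)) ω),
        Metric.infEDist x (A ω)) atTop (𝓝 0)

/-! ### The random linear differential equation -/

/-- The `N × N` tridiagonal generator with rates `q 1, …, q (2 N - 2)`: the column with (1-based)
index `J` has the entry `q (2 J - 2)` above the diagonal, `q (2 J - 1)` below it, and minus the sum
of these on it. The indices `i`, `j` of `Fin N` are 0-based, so `J = j + 1`. -/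
def generator (N : ℕ) (q : ℕ → ℝ) : Matrix (Fin N) (Fin N) ℝ :=
  Matrix.of fun i j =>
    if (i : ℕ) = j + 1 then q (2 * j + 1)
    else if (j : ℕ) = i + 1 then q (2 * j)
    else if i = j then
      -((if 0 < (j : ℕ) then q (2 * j) else 0) + (if (j : ℕ) + 1 < N then q (2 * j + 1) else 0))
    else 0

/-- `x` is a (Carathéodory) solution on `[0, ∞)` of `dx/dt = A(t) x`, `x(0) = p`: it is absolutely
continuous on bounded intervals and satisfies the equation almost everywhere. The values of `x` at
negative times are irrelevant. -/
structure IsSolution {N : ℕ} (A : ℝ → Matrix (Fin N) (Fin N) ℝ) (p : Fin N → ℝ)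
    (x : ℝ → Fin N → ℝ) : Prop where
  initial : x 0 = p
  absCont : ∀ T : ℝ, 0 ≤ T → AbsolutelyContinuousOnInterval x 0 T
  ode : ∀ᵐ t ∂(volume.restrict (Ioi (0 : ℝ))), HasDerivAt x (A t *ᵥ x t) t

/-- `φ` is the solution operator of the random equation `dp/dt = Q(θ_t ω) p`: for each `ω` and each
initial value `p`, the function `t ↦ φ t ω p` is the unique solution on `[0, ∞)`. -/
def IsSolutionOperator {Ω : Type*} {N : ℕ} (θ : ℝ → Ω → Ω) (Q : Ω → Matrix (Fin N) (Fin N) ℝ)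
    (φ : ℝ≥0 → Ω → (Fin N → ℝ) → (Fin N → ℝ)) : Prop :=
  ∀ (ω : Ω) (p : Fin N → ℝ) (x : ℝ → Fin N → ℝ),
    IsSolution (fun t => Q (θ t ω)) p x ↔ ∀ t : ℝ≥0, x t = φ t ω p

/-! ### The probability simplex and the Hilbert projective metric -/

/-- The probability simplex, with the topology and metric induced by the norm. -/
abbrev Simplex (N : ℕ) : Type := stdSimplex ℝ (Fin N)

/-- The (relative) interior of the probability simplex. -/
def openSimplex (N : ℕ) : Set (Simplex N) := {p | ∀ i, 0 < p.1 i}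

/-- A copy of the probability simplex that carries the Hilbert projective metric. -/
def HilbertSimplex (N : ℕ) : Type := Simplex N

namespace HilbertSimplex

variable {N : ℕ}

/-- Coordinates of a point. -/
def coord (x : HilbertSimplex N) : Fin N → ℝ := Subtype.val x

/-- Two points are comparable if they have the same zero coordinates, that is, if they lie in the
relative interior of the same face. -/
def Comparable (x y : HilbertSimplex N) : Prop := ∀ i, x.coord i = 0 ↔ y.coord i = 0

/-- `max_i y_i / x_i`; for comparable `x`, `y` the quotients `0 / 0 = 0` play no role. -/
noncomputable def ratio (x y : HilbertSimplex N) : ℝ := ⨆ i, y.coord i / x.coord i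

open Classical in
/-- The Hilbert projective metric `ln (max_i (y_i / x_i) · max_i (x_i / y_i))`, with the value `∞`
at pairs that are not comparable. On the open simplex it is finite. -/
noncomputable def hdist (x y : HilbertSimplex N) : ℝ≥0∞ :=
  if Comparable x y then ENNReal.ofReal (Real.log (ratio x y * ratio y x)) else ⊤

lemma coord_nonneg (x : HilbertSimplex N) (i : Fin N) : 0 ≤ x.coord i := x.2.1 i

lemma coord_sum (x : HilbertSimplex N) : ∑ i, x.coord i = 1 := x.2.2

lemma Comparable.symm {x y : HilbertSimplex N} (h : Comparable x y) : Comparable y x :=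
  fun i => (h i).symm

lemma Comparable.le_ratio_mul {x y : HilbertSimplex N} (h : Comparable x y) (i : Fin N) :
    y.coord i ≤ ratio x y * x.coord i := by
  by_cases hx : x.coord i = 0
  · rw [hx, (h i).1 hx, mul_zero]
  · have hpos : 0 < x.coord i := lt_of_le_of_ne (x.coord_nonneg i) (Ne.symm hx)
    rw [← div_le_iff₀ hpos]
    exact le_ciSup (f := fun i => y.coord i / x.coord i) (Set.finite_range _).bddAbove i

lemma Comparable.one_le_ratio {x y : HilbertSimplex N} (h : Comparable x y) :
    1 ≤ ratio x y := by
  have := Finset.sum_le_sum fun i (_ : i ∈ Finset.univ) => h.le_ratio_mul i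
  rwa [← Finset.mul_sum, x.coord_sum, y.coord_sum, mul_one] at this

lemma ratio_self (x : HilbertSimplex N) : ratio x x = 1 := by
  have h : Comparable x x := fun _ => Iff.rfl
  refine le_antisymm ?_ h.one_le_ratio
  exact Real.iSup_le (fun i => div_self_le_one _) zero_le_one

lemma ratio_le {x y z : HilbertSimplex N} (hxy : Comparable x y) (hyz : Comparable y z) :
    ratio x z ≤ ratio x y * ratio y z := by
  have h1 := hxy.one_le_ratio
  have h2 := hyz.one_le_ratio
  refine Real.iSup_le (fun i => ?_) (by positivity)
  refine div_le_of_le_mul₀ (x.coord_nonneg i) (by positivity) ?_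
  calc z.coord i ≤ ratio y z * y.coord i := hyz.le_ratio_mul i
    _ ≤ ratio y z * (ratio x y * x.coord i) := by
        gcongr
        exact hxy.le_ratio_mul i
    _ = ratio x y * ratio y z * x.coord i := by ring

noncomputable instance : EMetricSpace (HilbertSimplex N) where
  edist := hdist
  edist_self x := by
    change hdist x x = 0
    have h : Comparable x x := fun _ => Iff.rfl
    rw [hdist, if_pos h, ratio_self]
    simp
  edist_comm x y := by
    change hdist x y = hdist y x
    by_cases h : Comparable x y
    · rw [hdist, hdist, if_pos h, if_pos h.symm, mul_comm]
    · rw [hdist, hdist, if_neg h, if_neg fun h' => h h'.symm]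
  edist_triangle x y z := by
    change hdist x z ≤ hdist x y + hdist y z
    by_cases hxy : Comparable x y
    · by_cases hyz : Comparable y z
      · have hxz : Comparable x z := fun i => (hxy i).trans (hyz i)
        have a := hxy.one_le_ratio
        have b := hxy.symm.one_le_ratio
        have c := hyz.one_le_ratio
        have d := hyz.symm.one_le_ratio
        have e := hxz.one_le_ratio
        have f := hxz.symm.one_le_ratio
        rw [hdist, hdist, hdist, if_pos hxy, if_pos hyz, if_pos hxz,
          ← ENNReal.ofReal_add (Real.log_nonneg (one_le_mul_of_one_le_of_one_le a b))
            (Real.log_nonneg (one_le_mul_of_one_le_of_one_le c d)),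
          ← Real.log_mul (by positivity) (by positivity)]
        refine ENNReal.ofReal_le_ofReal (Real.log_le_log (by positivity) ?_)
        calc ratio x z * ratio z x
            ≤ (ratio x y * ratio y z) * (ratio z y * ratio y x) := by
              gcongr
              · exact ratio_le hxy hyz
              · exact ratio_le hyz.symm hxy.symm
          _ = ratio x y * ratio y x * (ratio y z * ratio z y) := by ring
      · simp [hdist, hyz]
    · simp [hdist, hxy]
  eq_of_edist_eq_zero {x y} h := by
    change hdist x y = 0 at h
    by_cases hxy : Comparable x y
    · rw [hdist, if_pos hxy, ENNReal.ofReal_eq_zero] at h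
      have a := hxy.one_le_ratio
      have b := hxy.symm.one_le_ratio
      have hle : ratio x y * ratio y x ≤ 1 := by
        by_contra hlt
        exact absurd (Real.log_pos (not_le.1 hlt)) (not_lt.2 h)
      have ha : ratio x y = 1 := le_antisymm (by nlinarith) a
      have hb : ratio y x = 1 := le_antisymm (by nlinarith) b
      refine Subtype.ext (funext fun i => le_antisymm ?_ ?_)
      · simpa [hb, coord] using hxy.symm.le_ratio_mul i
      · simpa [ha, coord] using hxy.le_ratio_mul i
    · simp [hdist, hxy] at h

end HilbertSimplex

end RandomMarkov

/-!
The proof rests on two facts about the matrix `Q + κ`, where `κ` is so large that the diagonal is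
positive: it is entrywise nonnegative, and its entries on the three central diagonals are at least
`c`. The solution of `p' = Q(θ_t ω) p` is `exp (-κ t)` times the Picard series of the equation with
`Q + κ`, a series of nonnegative terms if `p(0) ≥ 0`. Its zeroth term shows that the open simplex is
invariant. Its `N`-th term at time `1` has all components at least a fixed multiple of the total
mass, since `N` lazy nearest-neighbour steps connect any two of the `N` states (`le_picardTerm`,
`AdmissibleRates.mixingRate_mul_sum_le_flow`). The total mass itself is conserved because the
columns of `Q` sum to zero. The coefficients are only bounded and measurable in time, so solutions
in the sense of Carathéodory are identified with continuous solutions of the integral equation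
(`isSolution_iff_isIntegralSolution`), for which uniqueness follows by iterating the equation.

So each time-one map is linear, preserves mass, and gives every component at least a fraction `δ`
of the mass, with `δ > 0` independent of `ω`. Its image therefore has bounded Hilbert diameter, which
is uniform dissipativity. It also contracts the Hilbert metric by the factor `1 - δ`
(`HilbertSimplex.edist_map_le`, an elementary form of Birkhoff's theorem): if `y ≤ r x` with
`r ≥ 1`, applying the map to `r x - y`, of mass `r - 1`, improves the bound for the images to
`r / (1 + δ (r - 1)) ≤ r ^ (1 - δ)`, by Bernoulli's inequality.

Hence any two orbits over the same `ω` approach each other exponentially fast in the Hilbert metric,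
uniformly over all initial values and all `ω`, and thus also in norm
(`HilbertSimplex.dist_le_exp_sub_one`). The points `φ(t, θ_{-t} ω, x₀)` form a Cauchy net in the
simplex. The limit `a(ω)` is measurable as a limit of measurable maps, and invariant
because the time-`t` maps are continuous (`IsCocycle.exists_invariant_point`). It lies in the image
of a time-one map, so in the open simplex, where the Hilbert metric and the norm define the same
open sets. By invariance, attraction and stability reduce to comparing an orbit with the
orbit of `a` (`isRandomAttractor_singleton`).
-/

namespace RandomMarkov

/-! ### Linear equations with bounded measurable coefficients -/

section LinearEquation

variable {N : ℕ}

/-- `x` is a continuous solution on `[0, ∞)` of the integral equation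
`x(t) = p + ∫₀ᵗ A(s) x(s) ds`. -/
structure IsIntegralSolution (A : ℝ → Matrix (Fin N) (Fin N) ℝ) (p : Fin N → ℝ)
    (x : ℝ → Fin N → ℝ) : Prop where
  continuousOn : ContinuousOn x (Ici 0)
  eq : ∀ t : ℝ, 0 ≤ t → x t = p + ∫ s in (0 : ℝ)..t, A s *ᵥ x s

/-- The coefficient matrix depends measurably on time, and its operator norm for the sup norm is at
most `K` at all times. -/
structure IsBoundedMeasurable (A : ℝ → Matrix (Fin N) (Fin N) ℝ) (K : ℝ) : Prop where
  measurable : ∀ i j, Measurable fun t => A t i j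
  nonneg : 0 ≤ K
  bound : ∀ t v, ‖A t *ᵥ v‖ ≤ K * ‖v‖

variable {A : ℝ → Matrix (Fin N) (Fin N) ℝ} {K : ℝ} {p : Fin N → ℝ} {x y : ℝ → Fin N → ℝ}

lemma measurable_mulVec {α : Type*} [MeasurableSpace α] {M : α → Matrix (Fin N) (Fin N) ℝ}
    {v : α → Fin N → ℝ} (hM : ∀ i j, Measurable fun a => M a i j) (hv : Measurable v) :
    Measurable fun a => M a *ᵥ v a := by
  refine measurable_pi_iff.2 fun i => ?_
  simp only [Matrix.mulVec, dotProduct]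
  exact Finset.measurable_fun_sum _ fun j _ => (hM i j).mul ((measurable_pi_apply j).comp hv)

lemma norm_mulVec_le {M : Matrix (Fin N) (Fin N) ℝ} {b : ℝ} (hM : ∀ i j, |M i j| ≤ b)
    (hb : 0 ≤ b) (v : Fin N → ℝ) : ‖M *ᵥ v‖ ≤ N * b * ‖v‖ := by
  refine (pi_norm_le_iff_of_nonneg (by positivity)).2 fun i => ?_
  calc ‖(M *ᵥ v) i‖ ≤ ∑ j, ‖M i j * v j‖ :=
        norm_sum_le Finset.univ fun j => M i j * v j
    _ ≤ ∑ _j : Fin N, b * ‖v‖ := Finset.sum_le_sum fun j _ => by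
        rw [norm_mul]
        exact mul_le_mul (hM i j) (norm_le_pi_norm v j) (norm_nonneg _) hb
    _ = N * b * ‖v‖ := by simp [mul_assoc]

/-- Bounded measurable functions are integrable on bounded intervals. -/
lemma intervalIntegrable_of_bound {g : ℝ → Fin N → ℝ} {a b M : ℝ}
    (hg : AEStronglyMeasurable g (volume.restrict (uIoc a b)))
    (hM : ∀ s ∈ uIcc a b, ‖g s‖ ≤ M) : IntervalIntegrable g volume a b := by
  rw [intervalIntegrable_iff]
  have : IsFiniteMeasure (volume.restrict (uIoc a b)) :=
    inferInstanceAs (IsFiniteMeasure (volume.restrict (Ioc _ _)))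
  refine Integrable.of_bound hg M ?_
  filter_upwards [ae_restrict_mem measurableSet_uIoc] with s hs
  exact hM s (uIoc_subset_uIcc hs)

/-- The primitive of a bounded function is Lipschitz, hence absolutely continuous. -/
lemma lipschitzOnWith_primitive {g : ℝ → Fin N → ℝ} {T M : ℝ}
    (hg : IntervalIntegrable g volume 0 T) (hM : ∀ s ∈ uIcc 0 T, ‖g s‖ ≤ M) :
    LipschitzOnWith M.toNNReal (fun t => ∫ s in (0 : ℝ)..t, g s) (uIcc 0 T) := by
  refine LipschitzOnWith.of_dist_le_mul fun a ha b hb => ?_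
  have h0 : (0 : ℝ) ∈ uIcc 0 T := left_mem_uIcc
  rw [dist_eq_norm, intervalIntegral.integral_interval_sub_left
    (hg.mono_set (uIcc_subset_uIcc h0 ha)) (hg.mono_set (uIcc_subset_uIcc h0 hb)),
    Real.dist_eq, Real.coe_toNNReal _ ((norm_nonneg _).trans (hM 0 h0))]
  exact intervalIntegral.norm_integral_le_of_norm_le_const fun s hs =>
    hM s (uIcc_subset_uIcc hb ha (uIoc_subset_uIcc hs))

lemma continuousOn_Ici_of_uIcc (h : ∀ T : ℝ, 0 ≤ T → ContinuousOn x (uIcc 0 T)) :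
    ContinuousOn x (Ici 0) := by
  intro t ht
  have ht0 : 0 ≤ t := ht
  have h1 := h (t + 1) (by linarith)
  rw [uIcc_of_le (by linarith)] at h1
  refine (h1 t ⟨ht, by linarith⟩).mono_of_mem_nhdsWithin ?_
  filter_upwards [self_mem_nhdsWithin, mem_nhdsWithin_of_mem_nhds
    (Iio_mem_nhds (show t < t + 1 by linarith))] with s hs hs'
  exact ⟨hs, le_of_lt hs'⟩

namespace IsBoundedMeasurable

lemma aestronglyMeasurable_mulVec (hA : IsBoundedMeasurable A K) {a b : ℝ} (ha : 0 ≤ a)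
    (hb : 0 ≤ b) (hx : ContinuousOn x (Ici 0)) :
    AEStronglyMeasurable (fun s => A s *ᵥ x s) (volume.restrict (uIoc a b)) := by
  -- extend `x` continuously to negative times, where its values play no role
  have hc : Continuous fun s => x (max s 0) :=
    hx.comp_continuous (by fun_prop) fun s => mem_Ici.2 (le_max_right s 0)
  refine (measurable_mulVec hA.measurable hc.measurable).aestronglyMeasurable.congr ?_
  filter_upwards [ae_restrict_mem measurableSet_uIoc] with s hs
  have : 0 ≤ s := (le_min ha hb).trans hs.1.le
  simp [max_eq_left this]

lemma exists_bound (hA : IsBoundedMeasurable A K) {a b : ℝ} (ha : 0 ≤ a) (hb : 0 ≤ b)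
    (hx : ContinuousOn x (Ici 0)) : ∃ M, ∀ s ∈ uIcc a b, ‖A s *ᵥ x s‖ ≤ M := by
  have hsub : uIcc a b ⊆ Ici 0 := fun s hs => (le_min ha hb).trans hs.1
  obtain ⟨M, hM⟩ := isCompact_uIcc.exists_bound_of_continuousOn (hx.mono hsub)
  exact ⟨K * M, fun s hs => (hA.bound s _).trans
    (mul_le_mul_of_nonneg_left (hM s hs) hA.nonneg)⟩

lemma intervalIntegrable_mulVec (hA : IsBoundedMeasurable A K) {a b : ℝ} (ha : 0 ≤ a)
    (hb : 0 ≤ b) (hx : ContinuousOn x (Ici 0)) :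
    IntervalIntegrable (fun s => A s *ᵥ x s) volume a b := by
  obtain ⟨M, hM⟩ := hA.exists_bound ha hb hx
  exact intervalIntegrable_of_bound (hA.aestronglyMeasurable_mulVec ha hb hx) hM

/-- The estimate behind both the convergence of the Picard series and uniqueness: integration
raises a bound `a (K s)ⁿ / n!` to `a (K s)ⁿ⁺¹ / (n + 1)!`. -/
lemma norm_integral_le (hA : IsBoundedMeasurable A K) {a t : ℝ} (n : ℕ) (ht : 0 ≤ t)
    (hx : ∀ s ∈ Icc 0 t, ‖x s‖ ≤ a * ((K * s) ^ n / n.factorial)) :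
    ‖∫ s in (0 : ℝ)..t, A s *ᵥ x s‖ ≤ a * ((K * t) ^ (n + 1) / (n + 1).factorial) := by
  have h : ‖∫ s in (0 : ℝ)..t, A s *ᵥ x s‖
      ≤ ∫ s in (0 : ℝ)..t, K * (a * ((K * s) ^ n / n.factorial)) := by
    refine intervalIntegral.norm_integral_le_of_norm_le ht ?_
      (by apply Continuous.intervalIntegrable; fun_prop)
    filter_upwards with s hs
    exact (hA.bound s _).trans
      (mul_le_mul_of_nonneg_left (hx s (Ioc_subset_Icc_self hs)) hA.nonneg)
  refine h.trans_eq ?_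
  have hrw : ∀ s : ℝ, K * (a * ((K * s) ^ n / n.factorial))
      = (K * a * K ^ n / n.factorial) * s ^ n := fun s => by rw [mul_pow]; ring
  simp_rw [hrw]
  rw [intervalIntegral.integral_const_mul, integral_pow, Nat.factorial_succ]
  push_cast
  field_simp
  ring

end IsBoundedMeasurable

/-- The difference between a solution and `p + ∫₀ᵗ A x` is absolutely continuous with derivative zero
almost everywhere, hence constant. -/
lemma IsSolution.isIntegralSolution (hA : IsBoundedMeasurable A K) (h : IsSolution A p x) :
    IsIntegralSolution A p x := by
  have hc : ContinuousOn x (Ici 0) :=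
    continuousOn_Ici_of_uIcc fun T hT => (h.absCont T hT).continuousOn
  refine ⟨hc, fun t ht => ?_⟩
  obtain ⟨M, hM⟩ := hA.exists_bound le_rfl ht hc
  have hi := hA.intervalIntegrable_mulVec le_rfl ht hc
  have hz : AbsolutelyContinuousOnInterval
      (fun u => x u - ∫ s in (0 : ℝ)..u, A s *ᵥ x s) 0 t :=
    (h.absCont t ht).sub (lipschitzOnWith_primitive hi hM).absolutelyContinuousOnInterval
  have hd : ∀ᵐ u, u ∈ uIcc 0 t →
      HasDerivAt (fun u => x u - ∫ s in (0 : ℝ)..u, A s *ᵥ x s) 0 u := by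
    have h0 : ∀ᵐ u : ℝ, u ≠ 0 := by simp [ae_iff, measure_singleton]
    filter_upwards [(ae_restrict_iff' measurableSet_Ioi).1 h.ode, hi.ae_hasDerivAt_integral, h0]
      with u hu1 hu2 hu3 hu
    have hu0 : 0 < u := lt_of_le_of_ne (by rw [uIcc_of_le ht] at hu; exact hu.1) (Ne.symm hu3)
    have := (hu1 hu0).sub (hu2 hu 0 left_mem_uIcc)
    rwa [sub_self] at this
  obtain ⟨c, hcst⟩ := hz.const_of_ae_hasDerivAt_zero hd
  have e0 := hcst 0 left_mem_uIcc
  have et := hcst t right_mem_uIcc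
  simp only [intervalIntegral.integral_same, sub_zero, h.initial] at e0
  rw [e0, ← et]
  abel

/-- The converse is the Lebesgue differentiation theorem. -/
lemma IsIntegralSolution.isSolution (hA : IsBoundedMeasurable A K)
    (h : IsIntegralSolution A p x) : IsSolution A p x := by
  have hac : ∀ T : ℝ, 0 ≤ T → AbsolutelyContinuousOnInterval x 0 T := by
    intro T hT
    obtain ⟨M, hM⟩ := hA.exists_bound le_rfl hT h.continuousOn
    have hl := lipschitzOnWith_primitive
      (hA.intervalIntegrable_mulVec le_rfl hT h.continuousOn) hM
    refine LipschitzOnWith.absolutelyContinuousOnInterval (K := M.toNNReal) ?_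
    intro s hs t ht
    have hs0 : 0 ≤ s := by rw [uIcc_of_le hT] at hs; exact hs.1
    have ht0 : 0 ≤ t := by rw [uIcc_of_le hT] at ht; exact ht.1
    rw [h.eq s hs0, h.eq t ht0, edist_add_left]
    exact hl hs ht
  refine ⟨by simpa using h.eq 0 le_rfl, hac, ?_⟩
  rw [ae_restrict_iff' measurableSet_Ioi]
  have hall : ∀ n : ℕ, ∀ᵐ u, u ∈ Ioo (0 : ℝ) n → HasDerivAt x (A u *ᵥ x u) u := by
    intro n
    filter_upwards [(hA.intervalIntegrable_mulVec le_rfl n.cast_nonneg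
      h.continuousOn).ae_hasDerivAt_integral] with u hu hun
    have := (hu (by rw [uIcc_of_le n.cast_nonneg]; exact Ioo_subset_Icc_self hun) 0
      left_mem_uIcc).const_add p
    refine this.congr_of_eventuallyEq ?_
    filter_upwards [Ioi_mem_nhds hun.1] with s hs
    exact h.eq s (le_of_lt hs)
  filter_upwards [ae_all_iff.2 hall] with u hu hu0
  obtain ⟨n, hn⟩ := exists_nat_gt u
  exact hu n ⟨hu0, hn⟩

lemma isSolution_iff_isIntegralSolution (hA : IsBoundedMeasurable A K) :
    IsSolution A p x ↔ IsIntegralSolution A p x :=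
  ⟨fun h => h.isIntegralSolution hA, fun h => h.isSolution hA⟩

namespace IsIntegralSolution

lemma congr (h : IsIntegralSolution A p x) (hxy : ∀ t : ℝ, 0 ≤ t → y t = x t) :
    IsIntegralSolution A p y := by
  refine ⟨h.continuousOn.congr fun t ht => hxy t ht, fun t ht => ?_⟩
  rw [hxy t ht, h.eq t ht]
  congr 1
  refine intervalIntegral.integral_congr fun s hs => ?_
  rw [uIcc_of_le ht] at hs
  simp only [hxy s hs.1]

lemma add (hA : IsBoundedMeasurable A K) {p' : Fin N → ℝ} (hx : IsIntegralSolution A p x)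
    (hy : IsIntegralSolution A p' y) : IsIntegralSolution A (p + p') (fun t => x t + y t) := by
  refine ⟨hx.continuousOn.add hy.continuousOn, fun t ht => ?_⟩
  simp only [Matrix.mulVec_add]
  rw [intervalIntegral.integral_add (hA.intervalIntegrable_mulVec le_rfl ht hx.continuousOn)
    (hA.intervalIntegrable_mulVec le_rfl ht hy.continuousOn), hx.eq t ht, hy.eq t ht]
  abel

lemma const_smul (r : ℝ) (hx : IsIntegralSolution A p x) :
    IsIntegralSolution A (r • p) (fun t => r • x t) := by
  refine ⟨hx.continuousOn.const_smul r, fun t ht => ?_⟩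
  simp only [Matrix.mulVec_smul]
  rw [intervalIntegral.integral_smul, ← smul_add, ← hx.eq t ht]

lemma shift (hA : IsBoundedMeasurable A K) (hx : IsIntegralSolution A p x) {t : ℝ} (ht : 0 ≤ t) :
    IsIntegralSolution (fun s => A (t + s)) (x t) (fun s => x (t + s)) := by
  refine ⟨hx.continuousOn.comp (by fun_prop) fun s hs => add_nonneg ht hs, fun s hs => ?_⟩
  rw [intervalIntegral.integral_comp_add_left (fun u => A u *ᵥ x u) t, hx.eq t ht,
    hx.eq (t + s) (add_nonneg ht hs), add_zero, add_assoc,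
    intervalIntegral.integral_add_adjacent_intervals
      (hA.intervalIntegrable_mulVec le_rfl ht hx.continuousOn)
      (hA.intervalIntegrable_mulVec ht (add_nonneg ht hs) hx.continuousOn)]

/-- If all column sums of the coefficient matrix vanish, the total mass is conserved. -/
lemma sum_eq (hA : IsBoundedMeasurable A K) (hcol : ∀ t j, ∑ i, A t i j = 0)
    (hx : IsIntegralSolution A p x) {t : ℝ} (ht : 0 ≤ t) : ∑ i, x t i = ∑ i, p i := by
  let L : (Fin N → ℝ) →L[ℝ] ℝ := ∑ i, ContinuousLinearMap.proj (R := ℝ) i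
  have hL : ∀ v, L v = ∑ i, v i := fun v => by simp [L]
  have hz : ∀ s, L (A s *ᵥ x s) = 0 := by
    intro s
    rw [hL]
    simp only [Matrix.mulVec, dotProduct]
    rw [Finset.sum_comm]
    simp [← Finset.sum_mul, hcol]
  have e := congrArg L (hx.eq t ht)
  rw [map_add, ← L.intervalIntegral_comp_comm
    (hA.intervalIntegrable_mulVec le_rfl ht hx.continuousOn)] at e
  simpa [hz, hL] using e

/-- Iterating the integral equation `n` times bounds a solution with initial value zero by a multiple
of `(K t)ⁿ / n!`. -/
lemma eq_zero (hA : IsBoundedMeasurable A K) (hx : IsIntegralSolution A 0 x) {t : ℝ}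
    (ht : 0 ≤ t) : x t = 0 := by
  obtain ⟨M, hM⟩ := isCompact_Icc.exists_bound_of_continuousOn
    (hx.continuousOn.mono (Icc_subset_Ici_self : Icc 0 t ⊆ Ici 0))
  have hb : ∀ n : ℕ, ∀ s ∈ Icc 0 t, ‖x s‖ ≤ M * ((K * s) ^ n / n.factorial) := by
    intro n
    induction n with
    | zero => simpa using hM
    | succ n ih =>
      intro s hs
      rw [hx.eq s hs.1, zero_add]
      exact hA.norm_integral_le n hs.1 fun u hu => ih u ⟨hu.1, hu.2.trans hs.2⟩
  have hlim := (FloorSemiring.tendsto_pow_div_factorial_atTop (K * t)).const_mul M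
  rw [mul_zero] at hlim
  exact norm_le_zero_iff.1
    (ge_of_tendsto' hlim fun n => hb n t ⟨ht, le_rfl⟩)

lemma unique (hA : IsBoundedMeasurable A K) (hx : IsIntegralSolution A p x)
    (hy : IsIntegralSolution A p y) {t : ℝ} (ht : 0 ≤ t) : x t = y t := by
  have h := hx.add hA (hy.const_smul (-1))
  rw [show p + (-1 : ℝ) • p = 0 by simp] at h
  have := h.eq_zero hA ht
  rw [neg_one_smul, ← sub_eq_add_neg] at this
  exact sub_eq_zero.1 this

end IsIntegralSolution

/-- Multiplication by `exp (-κ t)` turns solutions for `A + κ` into solutions for `A`. -/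
lemma IsSolution.exp_smul {κ : ℝ} (h : IsSolution (fun t => A t + κ • 1) p x) :
    IsSolution A p (fun t => Real.exp (-κ * t) • x t) := by
  refine ⟨by simp [h.initial], fun T hT => ?_, ?_⟩
  · refine AbsolutelyContinuousOnInterval.smul (f := fun t => Real.exp (-κ * t)) ?_
      (h.absCont T hT)
    refine ContDiffOn.absolutelyContinuousOnInterval (ContDiff.contDiffOn ?_)
    fun_prop
  · filter_upwards [h.ode] with t ht
    have he : HasDerivAt (fun t => Real.exp (-κ * t)) (Real.exp (-κ * t) * (-κ)) t := by
      simpa using ((hasDerivAt_id t).const_mul (-κ)).exp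
    have hd := he.smul ht
    convert! hd using 1
    rw [Matrix.add_mulVec, Matrix.smul_mulVec, Matrix.one_mulVec, Matrix.mulVec_smul, smul_add,
      smul_smul, add_assoc, ← add_smul]
    simp

/-! ### The Picard series -/

/-- The `n`-th term of the Picard series of the equation `x' = A(t) x`, `x(0) = p`. -/
noncomputable def picardTerm (A : ℝ → Matrix (Fin N) (Fin N) ℝ) (p : Fin N → ℝ) :
    ℕ → ℝ → Fin N → ℝ
  | 0 => fun _ => p
  | n + 1 => fun t => ∫ s in (0 : ℝ)..t, A s *ᵥ picardTerm A p n s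

/-- The sum of the Picard series. -/
noncomputable def picardSum (A : ℝ → Matrix (Fin N) (Fin N) ℝ) (p : Fin N → ℝ) (t : ℝ) :
    Fin N → ℝ := ∑' n, picardTerm A p n t

/-- The terms of the Picard series are jointly measurable in time and a parameter of which the
coefficient matrix is a jointly measurable function. -/
lemma measurable_picardTerm {Ω : Type*} [MeasurableSpace Ω]
    {B : Ω → ℝ → Matrix (Fin N) (Fin N) ℝ}
    (hB : ∀ i j, Measurable fun z : Ω × ℝ => B z.1 z.2 i j) (p : Fin N → ℝ) (n : ℕ) :
    Measurable fun z : Ω × ℝ => picardTerm (B z.1) p n z.2 := by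
  induction n with
  | zero => exact measurable_const
  | succ n ih =>
    have hg : Measurable fun z : Ω × ℝ => B z.1 z.2 *ᵥ picardTerm (B z.1) p n z.2 :=
      measurable_mulVec hB ih
    -- rescaling makes the domain of integration independent of the time
    have he : ∀ z : Ω × ℝ, picardTerm (B z.1) p (n + 1) z.2 = z.2 • ∫ u in Ioc (0 : ℝ) 1,
        B z.1 (z.2 * u) *ᵥ picardTerm (B z.1) p n (z.2 * u) := by
      intro z
      rw [← intervalIntegral.integral_of_le zero_le_one,
        intervalIntegral.smul_integral_comp_mul_left
          (fun s => B z.1 s *ᵥ picardTerm (B z.1) p n s) z.2]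
      simp [picardTerm]
    simp_rw [he]
    refine measurable_snd.smul (StronglyMeasurable.measurable ?_)
    have hm : Measurable fun w : (Ω × ℝ) × ℝ => (w.1.1, w.1.2 * w.2) := by fun_prop
    exact StronglyMeasurable.integral_prod_right' (hg.comp hm).stronglyMeasurable

lemma continuousOn_picardTerm (hA : IsBoundedMeasurable A K) (p : Fin N → ℝ) (n : ℕ) :
    ContinuousOn (picardTerm A p n) (Ici 0) := by
  induction n with
  | zero => exact continuousOn_const
  | succ n ih =>
    refine continuousOn_Ici_of_uIcc fun T hT => ?_
    obtain ⟨M, hM⟩ := hA.exists_bound le_rfl hT ih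
    exact (lipschitzOnWith_primitive (hA.intervalIntegrable_mulVec le_rfl hT ih) hM).continuousOn

lemma norm_picardTerm_le (hA : IsBoundedMeasurable A K) (p : Fin N → ℝ) (n : ℕ) :
    ∀ t : ℝ, 0 ≤ t → ‖picardTerm A p n t‖ ≤ ‖p‖ * ((K * t) ^ n / n.factorial) := by
  induction n with
  | zero => intro t _; simp [picardTerm]
  | succ n ih =>
    intro t ht
    exact hA.norm_integral_le n ht fun s hs => ih s hs.1

lemma summable_picardBound (a r : ℝ) : Summable fun n : ℕ => a * (r ^ n / n.factorial) :=
  (Real.summable_pow_div_factorial r).mul_left a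

lemma hasSum_picardTerm (hA : IsBoundedMeasurable A K) (p : Fin N → ℝ) {t : ℝ} (ht : 0 ≤ t) :
    HasSum (fun n => picardTerm A p n t) (picardSum A p t) :=
  (Summable.of_norm_bounded (summable_picardBound ‖p‖ (K * t))
    fun n => norm_picardTerm_le hA p n t ht).hasSum

lemma measurable_picardSum {Ω : Type*} [MeasurableSpace Ω]
    {B : Ω → ℝ → Matrix (Fin N) (Fin N) ℝ}
    (hB : ∀ i j, Measurable fun z : Ω × ℝ => B z.1 z.2 i j)
    (hK : ∀ ω, IsBoundedMeasurable (B ω) K) (p : Fin N → ℝ) {t : ℝ} (ht : 0 ≤ t) :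
    Measurable fun ω => picardSum (B ω) p t := by
  have hterm : ∀ n, Measurable fun ω => picardTerm (B ω) p n t := fun n =>
    (measurable_picardTerm hB p n).comp
      (measurable_id.prodMk measurable_const : Measurable fun ω : Ω => (ω, t))
  refine measurable_of_tendsto_metrizable (f := fun n ω => ∑ m ∈ Finset.range n,
    picardTerm (B ω) p m t) (fun n => Finset.measurable_fun_sum _ fun m _ => hterm m)
    (tendsto_pi_nhds.2 fun ω => ?_)
  exact (hasSum_picardTerm (hK ω) p ht).tendsto_sum_nat

lemma isIntegralSolution_picardSum (hA : IsBoundedMeasurable A K) (p : Fin N → ℝ) :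
    IsIntegralSolution A p (picardSum A p) := by
  have hc : ContinuousOn (picardSum A p) (Ici 0) := by
    refine continuousOn_Ici_of_uIcc fun T hT => ?_
    rw [uIcc_of_le hT]
    refine continuousOn_tsum
      (fun n => (continuousOn_picardTerm hA p n).mono Icc_subset_Ici_self)
      (summable_picardBound ‖p‖ (K * T)) fun n t ht => ?_
    refine (norm_picardTerm_le hA p n t ht.1).trans ?_
    have := hA.nonneg
    have := ht.1
    have := ht.2
    gcongr
  have heq : ∀ t : ℝ, 0 ≤ t → HasSum (fun n => picardTerm A p (n + 1) t)
      (∫ s in (0 : ℝ)..t, A s *ᵥ picardSum A p s) := by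
    intro t ht
    refine intervalIntegral.hasSum_integral_of_dominated_convergence
      (F := fun n s => A s *ᵥ picardTerm A p n s)
      (fun n _ => K * (‖p‖ * ((K * t) ^ n / n.factorial)))
      (fun n =>
        hA.aestronglyMeasurable_mulVec le_rfl ht (continuousOn_picardTerm hA p n)) (fun n => ?_) ?_ (by simp) ?_
    · filter_upwards with s hs
      rw [uIoc_of_le ht] at hs
      refine (hA.bound s _).trans (mul_le_mul_of_nonneg_left ?_ hA.nonneg)
      refine (norm_picardTerm_le hA p n s hs.1.le).trans ?_
      have := hA.nonneg
      have := hs.1.le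
      have := hs.2
      gcongr
    · filter_upwards with s _
      exact (summable_picardBound ‖p‖ (K * t)).mul_left K
    · filter_upwards with s hs
      rw [uIoc_of_le ht] at hs
      exact ((A s).mulVecLin.continuous_of_finiteDimensional.tendsto _).comp
        (hasSum_picardTerm hA p hs.1.le) |>.congr fun u => map_sum (A s).mulVecLin _ _
  refine ⟨hc, fun t ht => ?_⟩
  rw [picardSum, (hasSum_picardTerm hA p ht).summable.tsum_eq_zero_add, (heq t ht).tsum_eq]
  rfl

end LinearEquation

/-! ### Positivity of the Picard series -/

section Positivity

variable {N : ℕ} {B : ℝ → Matrix (Fin N) (Fin N) ℝ} {K : ℝ} {p : Fin N → ℝ}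

lemma picardTerm_succ_apply (hB : IsBoundedMeasurable B K) (n : ℕ) {t : ℝ} (ht : 0 ≤ t)
    (i : Fin N) : picardTerm B p (n + 1) t i
      = ∫ s in (0 : ℝ)..t, ∑ j, B s i j * picardTerm B p n s j :=
  ((ContinuousLinearMap.proj (R := ℝ) (φ := fun _ : Fin N => ℝ) i).intervalIntegral_comp_comm
    (hB.intervalIntegrable_mulVec le_rfl ht (continuousOn_picardTerm hB p n))).symm

/-- Nonnegative coefficients make the Picard series a series of nonnegative terms, so that each single
term bounds the solution from below. -/
lemma picardTerm_nonneg (hB : IsBoundedMeasurable B K) (hB0 : ∀ t i j, 0 ≤ B t i j)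
    (hp : ∀ i, 0 ≤ p i) (n : ℕ) : ∀ t : ℝ, 0 ≤ t → ∀ i, 0 ≤ picardTerm B p n t i := by
  induction n with
  | zero => exact fun _ _ i => hp i
  | succ n ih =>
    intro t ht i
    rw [picardTerm_succ_apply hB n ht]
    exact intervalIntegral.integral_nonneg ht fun s hs =>
      Finset.sum_nonneg fun j _ => mul_nonneg (hB0 s i j) (ih s hs.1 j)

/-- If the entries of `B` on the three central diagonals are at least `c`, then mass spreads over
distance `n` in the `n`-th term of the Picard series: `n` lazy nearest-neighbour steps
lead from `j` to every `i` with `|i - j| ≤ n`. -/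
lemma le_picardTerm (hB : IsBoundedMeasurable B K) (hB0 : ∀ t i j, 0 ≤ B t i j) {c : ℝ}
    (hc : 0 ≤ c)
    (hBc : ∀ t (i j : Fin N), (i : ℕ) ≤ j + 1 → (j : ℕ) ≤ i + 1 → c ≤ B t i j)
    (hp : ∀ i, 0 ≤ p i) (j : Fin N) (n : ℕ) : ∀ t : ℝ, 0 ≤ t → ∀ i : Fin N,
      (i : ℕ) ≤ j + n → (j : ℕ) ≤ i + n →
      c ^ n * t ^ n / n.factorial * p j ≤ picardTerm B p n t i := by
  induction n with
  | zero =>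
    intro t _ i h1 h2
    obtain rfl : i = j := Fin.ext (by omega)
    simp [picardTerm]
  | succ n ih =>
    intro t ht i h1 h2
    obtain ⟨k, hk1, hk2, hk3, hk4⟩ : ∃ k : Fin N, (i : ℕ) ≤ k + 1 ∧ (k : ℕ) ≤ i + 1 ∧
        (k : ℕ) ≤ j + n ∧ (j : ℕ) ≤ k + n := by
      rcases lt_trichotomy i j with h | h | h
      · have := Fin.lt_def.1 h
        exact ⟨⟨i + 1, by omega⟩, by simp only; omega⟩
      · subst h
        exact ⟨i, by omega⟩
      · have := Fin.lt_def.1 h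
        exact ⟨⟨i - 1, by omega⟩, by simp only; omega⟩
    have hlow : ∫ s in (0 : ℝ)..t, c * (c ^ n * s ^ n / n.factorial * p j)
        ≤ picardTerm B p (n + 1) t i := by
      rw [picardTerm_succ_apply hB n ht]
      refine intervalIntegral.integral_mono_on ht
        (by apply Continuous.intervalIntegrable; fun_prop) ?_ fun s hs => ?_
      · have := hB.intervalIntegrable_mulVec le_rfl ht (continuousOn_picardTerm hB p n)
        exact ⟨(ContinuousLinearMap.proj (R := ℝ) (φ := fun _ : Fin N => ℝ) i).integrable_comp
          this.1, (ContinuousLinearMap.proj (R := ℝ) (φ := fun _ : Fin N => ℝ)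
          i).integrable_comp this.2⟩
      · have hpos := picardTerm_nonneg hB hB0 hp n s hs.1
        have h0 : 0 ≤ c ^ n * s ^ n / n.factorial * p j := by
          have := hs.1
          have := hp j
          positivity
        calc c * (c ^ n * s ^ n / n.factorial * p j)
            ≤ B s i k * picardTerm B p n s k :=
              mul_le_mul (hBc s i k hk1 hk2) (ih s hs.1 k hk3 hk4) h0 (hB0 s i k)
          _ ≤ ∑ k, B s i k * picardTerm B p n s k :=
              Finset.single_le_sum (f := fun k => B s i k * picardTerm B p n s k)
                (fun k _ => mul_nonneg (hB0 s i k) (hpos k)) (Finset.mem_univ k)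
    refine le_trans (le_of_eq ?_) hlow
    have hrw : ∀ s : ℝ, c * (c ^ n * s ^ n / n.factorial * p j)
        = (c * c ^ n / n.factorial * p j) * s ^ n := fun s => by ring
    simp_rw [hrw]
    rw [intervalIntegral.integral_const_mul, integral_pow, Nat.factorial_succ]
    push_cast
    field_simp
    ring

lemma picardTerm_le_picardSum (hB : IsBoundedMeasurable B K) (hB0 : ∀ t i j, 0 ≤ B t i j)
    (hp : ∀ i, 0 ≤ p i) (n : ℕ) {t : ℝ} (ht : 0 ≤ t) (i : Fin N) :
    picardTerm B p n t i ≤ picardSum B p t i :=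
  le_hasSum (Pi.hasSum.1 (hasSum_picardTerm hB p ht) i) n
    fun m _ => picardTerm_nonneg hB hB0 hp m t ht i

end Positivity

/-! ### The tridiagonal generator -/

section Generator

variable {N : ℕ} {q : ℕ → ℝ} {c C : ℝ}

lemma sum_generator (q : ℕ → ℝ) (j : Fin N) : ∑ i, generator N q i j = 0 := by
  have hsplit : ∀ i : Fin N, generator N q i j
      = (if (i : ℕ) = j + 1 then q (2 * j + 1) else 0) + (if (j : ℕ) = i + 1 then q (2 * j) else 0)
        + (if i = j then -((if 0 < (j : ℕ) then q (2 * j) else 0)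
          + (if (j : ℕ) + 1 < N then q (2 * j + 1) else 0)) else 0) := by
    intro i
    simp only [generator, Matrix.of_apply, Fin.ext_iff]
    split_ifs <;> first | omega | simp
  have h1 : ∑ i : Fin N, (if (i : ℕ) = j + 1 then q (2 * j + 1) else 0)
      = if (j : ℕ) + 1 < N then q (2 * j + 1) else 0 := by
    rw [Fin.sum_univ_eq_sum_range (fun i => if i = (j : ℕ) + 1 then q (2 * j + 1) else 0) N,
      Finset.sum_ite_eq']
    simp
  have h2 : ∑ i : Fin N, (if (j : ℕ) = i + 1 then q (2 * j) else 0)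
      = if 0 < (j : ℕ) then q (2 * j) else 0 := by
    rw [Fin.sum_univ_eq_sum_range (fun i => if (j : ℕ) = i + 1 then q (2 * j) else 0) N]
    have hj := j.2
    rcases Nat.eq_zero_or_pos (j : ℕ) with h0 | h0
    · simp [h0]
    · obtain ⟨k, hk⟩ : ∃ k, (j : ℕ) = k + 1 := ⟨j - 1, by omega⟩
      have he : ∀ i : ℕ, ((j : ℕ) = i + 1) = (k = i) := fun i => by
        rw [hk]; exact propext (by omega)
      simp only [he, Finset.sum_ite_eq, if_pos h0, Finset.mem_range]
      rw [if_pos (by omega)]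
  simp_rw [hsplit]
  rw [Finset.sum_add_distrib, Finset.sum_add_distrib, h1, h2, Finset.sum_ite_eq']
  simp
  ring

lemma measurable_generator {α : Type*} [MeasurableSpace α] {q : ℕ → α → ℝ}
    (hq : ∀ i ∈ Finset.Icc 1 (2 * N - 2), Measurable (q i)) (i j : Fin N) :
    Measurable fun a => generator N (fun k => q k a) i j := by
  have hi := i.2
  have hj := j.2
  have hup : 0 < (j : ℕ) → Measurable (q (2 * j)) := fun h =>
    hq _ (Finset.mem_Icc.2 (by omega))
  have hlow : (j : ℕ) + 1 < N → Measurable (q (2 * j + 1)) := fun h =>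
    hq _ (Finset.mem_Icc.2 (by omega))
  simp only [generator, Matrix.of_apply]
  by_cases h1 : (i : ℕ) = j + 1
  · simpa only [if_pos h1] using hlow (by omega)
  by_cases h2 : (j : ℕ) = i + 1
  · simpa only [if_neg h1, if_pos h2] using hup (by omega)
  by_cases h3 : i = j
  · simp only [if_neg h1, if_neg h2, if_pos h3]
    refine (Measurable.add ?_ ?_).neg
    · split_ifs with h
      exacts [hup h, measurable_const]
    · split_ifs with h
      exacts [hlow h, measurable_const]
  · simp only [if_neg h1, if_neg h2, if_neg h3]
    exact measurable_const

/-- A shift that makes the diagonal of the generator positive (at least `c`), whatever the rates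
between `c` and `C`. For `N = 1` there are no rates and `C` may be negative. -/
def diagShift (c C : ℝ) : ℝ := 2 * |C| + c

/-- The shifted generator is nonnegative, bounded, and at least `c` on the three central
diagonals. -/
lemma shifted_generator_bounds (hc : 0 < c)
    (hq : ∀ i ∈ Finset.Icc 1 (2 * N - 2), c ≤ q i ∧ q i ≤ C) (i j : Fin N) :
    0 ≤ (generator N q + diagShift c C • 1) i j ∧
    (generator N q + diagShift c C • 1) i j ≤ diagShift c C ∧
    ((i : ℕ) ≤ j + 1 → (j : ℕ) ≤ i + 1 → c ≤ (generator N q + diagShift c C • 1) i j) := by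
  have hi := i.2
  have hj := j.2
  have hup : 0 < (j : ℕ) → c ≤ q (2 * j) ∧ q (2 * j) ≤ |C| := fun h =>
    (hq _ (Finset.mem_Icc.2 (by omega))).imp_right fun h => h.trans (le_abs_self C)
  have hlow : (j : ℕ) + 1 < N → c ≤ q (2 * j + 1) ∧ q (2 * j + 1) ≤ |C| := fun h =>
    (hq _ (Finset.mem_Icc.2 (by omega))).imp_right fun h => h.trans (le_abs_self C)
  have hC := abs_nonneg C
  simp only [generator, diagShift, Matrix.add_apply, Matrix.of_apply, Matrix.smul_apply,
    Matrix.one_apply, smul_eq_mul]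
  by_cases h1 : (i : ℕ) = j + 1
  · have hne : i ≠ j := fun h => by rw [h] at h1; omega
    have := hlow (by omega)
    simp only [if_pos h1, if_neg hne]
    refine ⟨?_, ?_, fun _ _ => ?_⟩ <;> linarith
  by_cases h2 : (j : ℕ) = i + 1
  · have hne : i ≠ j := fun h => by rw [h] at h2; omega
    have := hup (by omega)
    simp only [if_neg h1, if_pos h2, if_neg hne]
    refine ⟨?_, ?_, fun _ _ => ?_⟩ <;> linarith
  by_cases h3 : i = j
  · simp only [if_neg h1, if_neg h2, if_pos h3]
    split_ifs with h4 h5 h5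
    · have := hup h4
      have := hlow h5
      refine ⟨?_, ?_, fun _ _ => ?_⟩ <;> linarith
    · have := hup h4
      refine ⟨?_, ?_, fun _ _ => ?_⟩ <;> linarith
    · have := hlow h5
      refine ⟨?_, ?_, fun _ _ => ?_⟩ <;> linarith
    · refine ⟨?_, ?_, fun _ _ => ?_⟩ <;> linarith
  · have : ¬ ((i : ℕ) ≤ j + 1 ∧ (j : ℕ) ≤ i + 1) := fun h => h3 (Fin.ext (by omega))
    simp only [if_neg h1, if_neg h2, if_neg h3]
    refine ⟨by linarith, by linarith, fun h h' => absurd ⟨h, h'⟩ this⟩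

end Generator

/-! ### The flow of the linear equation -/

/-- The time-dependent rates `q` are measurable and lie between `c > 0` and `C`. Only the indices
that occur in the generator are constrained. -/
structure AdmissibleRates (N : ℕ) (c C : ℝ) (q : ℝ → ℕ → ℝ) : Prop where
  pos : 0 < c
  measurable : ∀ i ∈ Finset.Icc 1 (2 * N - 2), Measurable fun t => q t i
  bounds : ∀ t, ∀ i ∈ Finset.Icc 1 (2 * N - 2), c ≤ q t i ∧ q t i ≤ C

/-- The solution at time `t` of `x' = A(t) x`, `x(0) = p`, written as `exp (-κ t)` times the
Picard series for `A + κ`. -/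
noncomputable def flow {N : ℕ} (A : ℝ → Matrix (Fin N) (Fin N) ℝ) (κ : ℝ) (p : Fin N → ℝ)
    (t : ℝ) : Fin N → ℝ :=
  Real.exp (-κ * t) • picardSum (fun s => A s + κ • 1) p t

/-- A lower bound for the entries of the fundamental matrix at time `1`, capped at `1 / 2`. -/
noncomputable def mixingRate (N : ℕ) (c C : ℝ) : ℝ :=
  min (1 / 2) (Real.exp (-diagShift c C) * (c ^ N / N.factorial) / N)

namespace AdmissibleRates

variable {N : ℕ} {c C : ℝ} {q : ℝ → ℕ → ℝ} {p : Fin N → ℝ}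

lemma diagShift_pos (h : AdmissibleRates N c C q) : 0 < diagShift c C := by
  have := h.pos
  rw [diagShift]
  positivity

lemma isBoundedMeasurable_shifted (h : AdmissibleRates N c C q) :
    IsBoundedMeasurable (fun t => generator N (q t) + diagShift c C • 1)
      (N * diagShift c C) where
  measurable i j := (measurable_generator h.measurable i j).add_const _
  nonneg := mul_nonneg N.cast_nonneg h.diagShift_pos.le
  bound t v := by
    refine norm_mulVec_le (fun i j => ?_) h.diagShift_pos.le v
    obtain ⟨h1, h2, -⟩ := shifted_generator_bounds h.pos (h.bounds t) i j
    rwa [abs_of_nonneg h1]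

lemma isBoundedMeasurable (h : AdmissibleRates N c C q) :
    IsBoundedMeasurable (fun t => generator N (q t)) (N * diagShift c C + diagShift c C) where
  measurable := measurable_generator h.measurable
  nonneg := add_nonneg h.isBoundedMeasurable_shifted.nonneg h.diagShift_pos.le
  bound t v := by
    have h1 := h.isBoundedMeasurable_shifted.bound t v
    have h2 : generator N (q t) *ᵥ v
        = (generator N (q t) + diagShift c C • 1) *ᵥ v - diagShift c C • v := by
      rw [Matrix.add_mulVec, Matrix.smul_mulVec, Matrix.one_mulVec, add_sub_cancel_right]
    rw [h2, add_mul]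
    refine (norm_sub_le _ _).trans (add_le_add h1 ?_)
    rw [norm_smul, Real.norm_of_nonneg h.diagShift_pos.le]

lemma isIntegralSolution_flow (h : AdmissibleRates N c C q) (p : Fin N → ℝ) :
    IsIntegralSolution (fun t => generator N (q t)) p
      (flow (fun t => generator N (q t)) (diagShift c C) p) :=
  ((isIntegralSolution_picardSum h.isBoundedMeasurable_shifted p).isSolution
    h.isBoundedMeasurable_shifted).exp_smul.isIntegralSolution h.isBoundedMeasurable

lemma isSolution_iff (h : AdmissibleRates N c C q) {x : ℝ → Fin N → ℝ} :
    IsSolution (fun t => generator N (q t)) p x ↔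
      ∀ t : ℝ, 0 ≤ t → x t = flow (fun t => generator N (q t)) (diagShift c C) p t := by
  rw [isSolution_iff_isIntegralSolution h.isBoundedMeasurable]
  exact ⟨fun hx t ht => hx.unique h.isBoundedMeasurable (h.isIntegralSolution_flow p) ht,
    fun hx => (h.isIntegralSolution_flow p).congr hx⟩

/-- The time-`t` map of the flow as a linear map. -/
noncomputable def flowMap (h : AdmissibleRates N c C q) {t : ℝ} (ht : 0 ≤ t) :
    (Fin N → ℝ) →ₗ[ℝ] (Fin N → ℝ) where
  toFun p := flow (fun t => generator N (q t)) (diagShift c C) p t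
  map_add' p p' := (h.isIntegralSolution_flow _).unique h.isBoundedMeasurable
    ((h.isIntegralSolution_flow p).add h.isBoundedMeasurable (h.isIntegralSolution_flow p')) ht
  map_smul' r p := (h.isIntegralSolution_flow _).unique h.isBoundedMeasurable
    ((h.isIntegralSolution_flow p).const_smul r) ht

lemma sum_flow (h : AdmissibleRates N c C q) (p : Fin N → ℝ) {t : ℝ} (ht : 0 ≤ t) :
    ∑ i, flow (fun t => generator N (q t)) (diagShift c C) p t i = ∑ i, p i :=
  (h.isIntegralSolution_flow p).sum_eq h.isBoundedMeasurable (fun _ => sum_generator _) ht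

lemma exp_mul_picardTerm_le_flow (h : AdmissibleRates N c C q) (hp : ∀ i, 0 ≤ p i) (n : ℕ)
    {t : ℝ} (ht : 0 ≤ t) (i : Fin N) :
    Real.exp (-diagShift c C * t)
      * picardTerm (fun s => generator N (q s) + diagShift c C • 1) p n t i
      ≤ flow (fun t => generator N (q t)) (diagShift c C) p t i :=
  mul_le_mul_of_nonneg_left (picardTerm_le_picardSum h.isBoundedMeasurable_shifted
    (fun s i j => (shifted_generator_bounds h.pos (h.bounds s) i j).1) hp n ht i)
    (Real.exp_pos _).le

lemma exp_mul_le_flow (h : AdmissibleRates N c C q) (hp : ∀ i, 0 ≤ p i) {t : ℝ} (ht : 0 ≤ t)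
    (i : Fin N) : Real.exp (-diagShift c C * t) * p i
      ≤ flow (fun t => generator N (q t)) (diagShift c C) p t i :=
  h.exp_mul_picardTerm_le_flow hp 0 ht i

/-- At time `1` every component of the solution is bounded below by a fixed multiple of the total
mass. -/
lemma mixingRate_mul_sum_le_flow (h : AdmissibleRates N c C q) (hp : ∀ i, 0 ≤ p i)
    (i : Fin N) : mixingRate N c C * ∑ j, p j
      ≤ flow (fun t => generator N (q t)) (diagShift c C) p 1 i := by
  have hN : (0 : ℝ) < N := Nat.cast_pos.2 i.pos
  have key : ∀ j, Real.exp (-diagShift c C) * (c ^ N / N.factorial) * p j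
      ≤ flow (fun t => generator N (q t)) (diagShift c C) p 1 i := by
    intro j
    have h1 := le_picardTerm h.isBoundedMeasurable_shifted
      (fun s i j => (shifted_generator_bounds h.pos (h.bounds s) i j).1) h.pos.le
      (fun s i j => (shifted_generator_bounds h.pos (h.bounds s) i j).2.2) hp j N 1 zero_le_one i
      (by have := i.2; omega) (by have := j.2; omega)
    have h2 := h.exp_mul_picardTerm_le_flow hp N zero_le_one i
    rw [one_pow, mul_one] at h1
    rw [mul_one] at h2
    rw [mul_assoc]
    exact (mul_le_mul_of_nonneg_left h1 (Real.exp_pos _).le).trans h2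
  have hs := Finset.sum_le_sum fun j (_ : j ∈ Finset.univ) => key j
  rw [← Finset.mul_sum, Finset.sum_const, Finset.card_univ, Fintype.card_fin, nsmul_eq_mul] at hs
  have h0 : 0 ≤ ∑ j, p j := Finset.sum_nonneg fun j _ => hp j
  refine (mul_le_mul_of_nonneg_right (min_le_right _ _) h0).trans ?_
  rw [div_mul_eq_mul_div, div_le_iff₀ hN, mul_comm _ (N : ℝ)]
  exact hs

end AdmissibleRates

lemma mixingRate_pos {N : ℕ} {c : ℝ} (hN : 1 ≤ N) (hc : 0 < c) (C : ℝ) :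
    0 < mixingRate N c C := by
  have : (0 : ℝ) < N := Nat.cast_pos.2 hN
  exact lt_min (by norm_num) (by positivity)

lemma mixingRate_lt_one (N : ℕ) (c C : ℝ) : mixingRate N c C < 1 :=
  (min_le_left _ _).trans_lt (by norm_num)

/-! ### The Hilbert projective metric -/

namespace HilbertSimplex

variable {N : ℕ} {x y x' y' : HilbertSimplex N}

lemma coord_le_one (x : HilbertSimplex N) (i : Fin N) : x.coord i ≤ 1 :=
  (Finset.single_le_sum (fun j _ => x.coord_nonneg j) (Finset.mem_univ i)).trans_eq x.coord_sum

lemma comparable_of_pos (hx : ∀ i, 0 < x.coord i) (hy : ∀ i, 0 < y.coord i) : Comparable x y :=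
  fun i => iff_of_false (hx i).ne' (hy i).ne'

lemma ratio_le_of_le {r : ℝ} (hr : 0 ≤ r) (h : ∀ i, y.coord i ≤ r * x.coord i) :
    ratio x y ≤ r :=
  Real.iSup_le (fun i => div_le_of_le_mul₀ (x.coord_nonneg i) hr (h i)) hr

lemma edist_of_comparable (h : Comparable x y) :
    edist x y = ENNReal.ofReal (Real.log (ratio x y * ratio y x)) := if_pos h

lemma edist_of_not_comparable (h : ¬ Comparable x y) : edist x y = ⊤ := if_neg h

lemma edist_le_of_ratio_le (h : Comparable x y) {r s : ℝ} (hr : ratio x y ≤ r)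
    (hs : ratio y x ≤ s) : edist x y ≤ ENNReal.ofReal (Real.log (r * s)) := by
  have h1 := h.one_le_ratio
  have h2 := h.symm.one_le_ratio
  rw [edist_of_comparable h]
  refine ENNReal.ofReal_le_ofReal (Real.log_le_log (by positivity) ?_)
  gcongr
  linarith

/-- Points with all coordinates at least `δ` are at bounded Hilbert distance. -/
lemma edist_le_of_le_coord {δ : ℝ} (hδ : 0 < δ) (hx : ∀ i, δ ≤ x.coord i)
    (hy : ∀ i, δ ≤ y.coord i) : edist x y ≤ ENNReal.ofReal (Real.log (δ⁻¹ * δ⁻¹)) := by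
  have key : ∀ u v : HilbertSimplex N, (∀ i, δ ≤ u.coord i) → ratio u v ≤ δ⁻¹ := by
    intro u v hu
    refine ratio_le_of_le (by positivity) fun i => (v.coord_le_one i).trans ?_
    rw [inv_mul_eq_div, one_le_div hδ]
    exact hu i
  exact edist_le_of_ratio_le (comparable_of_pos (fun i => hδ.trans_le (hx i))
    fun i => hδ.trans_le (hy i)) (key x y hx) (key y x hy)

/-- The Hilbert metric dominates the norm. -/
lemma dist_le_exp_sub_one {x y : Simplex N} {L : ℝ} (hL : 0 ≤ L)
    (h : edist (α := HilbertSimplex N) x y ≤ ENNReal.ofReal L) : dist x y ≤ Real.exp L - 1 := by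
  have hc : Comparable x y := by
    by_contra hc
    rw [edist_of_not_comparable hc] at h
    exact ENNReal.ofReal_ne_top (top_le_iff.1 h)
  have h1 := hc.one_le_ratio
  have h2 := hc.symm.one_le_ratio
  rw [edist_of_comparable hc, ENNReal.ofReal_le_ofReal_iff hL,
    Real.log_le_iff_le_exp (by positivity)] at h
  have key : ∀ u v : HilbertSimplex N, Comparable u v → ratio u v ≤ Real.exp L →
      ∀ i, v.coord i - u.coord i ≤ Real.exp L - 1 := by
    intro u v huv hr i
    have h3 := huv.le_ratio_mul i
    have h4 := huv.one_le_ratio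
    have h5 := u.coord_le_one i
    nlinarith
  have hxy := key x y hc ((le_mul_of_one_le_right (by linarith) h2).trans h)
  have hyx := key y x hc.symm ((le_mul_of_one_le_left (by linarith) h1).trans h)
  rw [Subtype.dist_eq, dist_pi_le_iff (by linarith [Real.add_one_le_exp L])]
  exact fun i => abs_sub_le_iff.2 ⟨hyx i, hxy i⟩

/-- On the open simplex, sets that are open for the Hilbert metric are open for the norm. -/
lemma isOpen_openSimplex_inter {U : Set (HilbertSimplex N)} (hU : IsOpen U) :
    IsOpen (X := Simplex N) {x | x ∈ openSimplex N ∧ x ∈ U} := by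
  rw [isOpen_iff_mem_nhds]
  rintro x ⟨hx, hxU⟩
  have hx0 : ∀ i, 0 < x.1 i := hx
  obtain ⟨ε, hε, hball⟩ := EMetric.isOpen_iff.1 hU x hxU
  have hlim : Tendsto (fun r : ℝ => ENNReal.ofReal (Real.log (r * r))) (𝓝[>] 1) (𝓝 0) := by
    have hca : ContinuousAt (fun r : ℝ => Real.log (r * r)) 1 :=
      ContinuousAt.log (by fun_prop) (by norm_num)
    have := ENNReal.tendsto_ofReal hca.tendsto
    simp only [mul_one, Real.log_one, ENNReal.ofReal_zero] at this
    exact this.mono_left nhdsWithin_le_nhds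
  obtain ⟨r, hr, hr1⟩ := ((hlim.eventually (gt_mem_nhds hε)).and self_mem_nhdsWithin).exists
  have hr1 : 1 < r := hr1
  have hcont : ∀ i, Continuous fun y : Simplex N => y.1 i := fun i =>
    (continuous_apply i).comp continuous_subtype_val
  have hnear : ∀ᶠ y : Simplex N in 𝓝 x, ∀ i, y.1 i < r * x.1 i ∧ x.1 i < r * y.1 i := by
    refine eventually_all.2 fun i => ?_
    have hlt : x.1 i < r * x.1 i := lt_mul_of_one_lt_left (hx0 i) hr1
    exact ((hcont i).continuousAt.eventually (gt_mem_nhds hlt)).and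
      (((hcont i).const_mul r).continuousAt.eventually (lt_mem_nhds hlt))
  filter_upwards [hnear] with y hy
  have hy0 : ∀ i, 0 < y.1 i := fun i =>
    pos_of_mul_pos_right ((hx0 i).trans (hy i).2) (by linarith)
  refine ⟨hy0, hball ?_⟩
  have hc : Comparable y x := comparable_of_pos hy0 hx0
  exact (edist_le_of_ratio_le hc (ratio_le_of_le (by linarith) fun i => (hy i).2.le)
    (ratio_le_of_le (by linarith) fun i => (hy i).1.le)).trans_lt hr

section Contraction

variable {F : (Fin N → ℝ) →ₗ[ℝ] (Fin N → ℝ)} {δ : ℝ}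

/-- If a linear map gives every component at least a fraction `δ` of the total mass, then it brings
all ratios closer to `1`. The map is applied to the nonnegative vector `ratio x y • x - y`. -/
lemma ratio_le_rpow (hδ0 : 0 < δ) (hδ1 : δ < 1)
    (hF : ∀ v : Fin N → ℝ, (∀ i, 0 ≤ v i) → ∀ i, δ * ∑ j, v j ≤ F v i)
    (hx' : x'.coord = F x.coord) (hy' : y'.coord = F y.coord) (h : Comparable x y) :
    ratio x' y' ≤ ratio x y ^ (1 - δ) := by
  have hr := h.one_le_ratio
  have hle := fun i => h.le_ratio_mul i
  set r := ratio x y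
  have hr0 : 0 < r := by linarith
  refine ratio_le_of_le (by positivity) fun i => ?_
  have h1 := hF (r • x.coord - y.coord) (fun j => by simpa using hle j) i
  have hsum : ∑ j, (r • x.coord - y.coord) j = r - 1 := by
    simp [← Finset.mul_sum, x.coord_sum, y.coord_sum]
  rw [hsum, map_sub, map_smul, ← hx', ← hy', Pi.sub_apply, Pi.smul_apply, smul_eq_mul] at h1
  have h2 : r ^ δ ≤ 1 + δ * (r - 1) := by
    have := rpow_one_add_le_one_add_mul_self (s := r - 1) (by linarith) hδ0.le hδ1.le
    simpa using this
  have h3 : r ^ δ * y'.coord i ≤ r * x'.coord i := by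
    have h4 := mul_le_mul_of_nonneg_right h2 (y'.coord_nonneg i)
    have h5 : δ * (r - 1) * y'.coord i ≤ δ * (r - 1) :=
      mul_le_of_le_one_right (mul_nonneg hδ0.le (by linarith)) (y'.coord_le_one i)
    linarith
  have h6 : r = r ^ δ * r ^ (1 - δ) := by
    rw [← Real.rpow_add hr0, add_sub_cancel, Real.rpow_one]
  have h7 : 0 < r ^ δ := by positivity
  refine le_of_mul_le_mul_left ?_ h7
  rw [← mul_assoc, ← h6]
  exact h3

/-- Birkhoff's contraction theorem, with a nonoptimal constant. -/
lemma edist_map_le (hδ0 : 0 < δ) (hδ1 : δ < 1)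
    (hF : ∀ v : Fin N → ℝ, (∀ i, 0 ≤ v i) → ∀ i, δ * ∑ j, v j ≤ F v i)
    (hx' : x'.coord = F x.coord) (hy' : y'.coord = F y.coord) :
    edist x' y' ≤ ENNReal.ofReal (1 - δ) * edist x y := by
  by_cases h : Comparable x y
  · have hpos : ∀ u u' : HilbertSimplex N, u'.coord = F u.coord → ∀ i, 0 < u'.coord i := by
      intro u u' hu i
      have := hF u.coord u.coord_nonneg i
      rw [u.coord_sum, mul_one, ← hu] at this
      exact hδ0.trans_le this
    have h1 := h.one_le_ratio
    have h2 := h.symm.one_le_ratio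
    refine (edist_le_of_ratio_le (comparable_of_pos (hpos x x' hx') (hpos y y' hy'))
      (ratio_le_rpow hδ0 hδ1 hF hx' hy' h) (ratio_le_rpow hδ0 hδ1 hF hy' hx' h.symm)).trans_eq ?_
    rw [← Real.mul_rpow (by positivity) (by positivity), Real.log_rpow (by positivity),
      ENNReal.ofReal_mul (by linarith), edist_of_comparable h]
  · rw [edist_of_not_comparable h, ENNReal.mul_top (by simpa using hδ1)]
    exact le_top

end Contraction

end HilbertSimplex

/-! ### Pullback limits of uniformly contracting cocycles -/

section Cocycle

variable {Ω M : Type*} {θ : ℝ → Ω → Ω} {φ : ℝ≥0 → Ω → M → M}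

/-- An orbit that starts at time `-(s + t)` and arrives at time `0` passes through time `-t`. -/
lemma IsCocycle.pullback_add (hφ : IsCocycle θ φ) (hadd : ∀ t s ω, θ t (θ s ω) = θ (t + s) ω)
    (s t : ℝ≥0) (ω : Ω) (x : M) :
    φ (s + t) (θ (-((s + t : ℝ≥0) : ℝ)) ω) x
      = φ t (θ (-(t : ℝ)) ω) (φ s (θ (-((s + t : ℝ≥0) : ℝ)) ω) x) := by
  rw [hφ.add, hadd]
  congr 2
  push_cast
  ring

/-- A one-step contraction with a bounded image contracts exponentially, uniformly over all initial
values. -/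
lemma IsCocycle.edist_le_pow [EMetricSpace M] (hφ : IsCocycle θ φ) {lam : ℝ≥0} {R : ℝ≥0∞}
    (hcontr : ∀ ω x y, edist (φ 1 ω x) (φ 1 ω y) ≤ lam * edist x y)
    (hbdd : ∀ ω x y, edist (φ 1 ω x) (φ 1 ω y) ≤ R) (n : ℕ) :
    ∀ t : ℝ≥0, (n + 1 : ℝ≥0) ≤ t → ∀ ω x y, edist (φ t ω x) (φ t ω y) ≤ lam ^ n * R := by
  induction n with
  | zero =>
    intro t ht ω x y
    obtain ⟨s, rfl⟩ : ∃ s, t = s + 1 := ⟨t - 1, (tsub_add_cancel_of_le (by simpa using ht)).symm⟩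
    simpa only [pow_zero, one_mul, hφ.add s 1] using hbdd (θ s ω) (φ s ω x) (φ s ω y)
  | succ n ih =>
    intro t ht ω x y
    push_cast at ht
    obtain ⟨s, rfl⟩ : ∃ s, t = s + 1 :=
      ⟨t - 1, (tsub_add_cancel_of_le (le_add_self.trans ht)).symm⟩
    rw [hφ.add s 1, hφ.add s 1, pow_succ', mul_assoc]
    exact (hcontr _ _ _).trans
      (mul_le_mul_right (ih s (le_of_add_le_add_right ht) ω x y) _)

/-- An invariant measurable point is a random attractor if orbits approach each other uniformly
over all initial values and all `ω`. -/
lemma isRandomAttractor_singleton [MeasurableSpace Ω] [EMetricSpace M]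
    (hzero : θ 0 = id) (hadd : ∀ t s ω, θ t (θ s ω) = θ (t + s) ω) {a : Ω → M}
    (hmeas : ∀ U : Set M, IsOpen U → MeasurableSet {ω | a ω ∈ U})
    (hinv : ∀ (t : ℝ≥0) ω, φ t ω (a ω) = a (θ t ω)) {b : ℝ≥0 → ℝ≥0∞}
    (hb : Tendsto b atTop (𝓝 0))
    (hφb : ∀ᶠ t in atTop, ∀ ω x y, edist (φ t ω x) (φ t ω y) ≤ b t) :
    IsRandomAttractor θ φ fun ω => {a ω} where
  nonempty ω := singleton_nonempty _
  isCompact ω := isCompact_singleton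
  measurable U hU := by simpa using hmeas U hU
  invariant t ω := by rw [image_singleton, hinv]
  attracts D _ _ _ ω := by
    refine tendsto_of_tendsto_of_tendsto_of_le_of_le' tendsto_const_nhds hb
      (Eventually.of_forall fun _ => zero_le) ?_
    filter_upwards [hφb] with t ht
    refine iSup₂_le ?_
    rintro _ ⟨x, -, rfl⟩
    have ha : a ω = φ t (θ (-(t : ℝ)) ω) (a (θ (-(t : ℝ)) ω)) := by
      rw [hinv, hadd, add_neg_cancel, hzero, id]
    rw [Metric.infEDist_singleton, ha]
    exact ht _ _ _

/-- The pullback limit of a cocycle whose orbits approach each other uniformly is an invariant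
random point. -/
lemma IsCocycle.exists_invariant_point [MetricSpace M] [CompleteSpace M] [Nonempty M]
    (hφ : IsCocycle θ φ) (hzero : θ 0 = id) (hadd : ∀ t s ω, θ t (θ s ω) = θ (t + s) ω)
    (hcont : ∀ t ω, Continuous (φ t ω)) {b : ℝ≥0 → ℝ}
    (hb : Tendsto b atTop (𝓝 0))
    (hφb : ∀ᶠ t in atTop, ∀ ω x y, dist (φ t ω x) (φ t ω y) ≤ b t) :
    ∃ (a : Ω → M) (x₀ : M), (∀ (t : ℝ≥0) ω, φ t ω (a ω) = a (θ t ω)) ∧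
      ∀ ω, Tendsto (fun t : ℝ≥0 => φ t (θ (-(t : ℝ)) ω) x₀) atTop (𝓝 (a ω)) := by
  obtain ⟨x₀⟩ := ‹Nonempty M›
  have hlim : ∀ ω, ∃ l, Tendsto (fun t : ℝ≥0 => φ t (θ (-(t : ℝ)) ω) x₀) atTop (𝓝 l) := by
    intro ω
    refine cauchySeq_tendsto_of_complete (Metric.cauchySeq_iff'.2 fun ε hε => ?_)
    obtain ⟨t, ht, htε⟩ := (hφb.and (hb.eventually (gt_mem_nhds hε))).exists
    refine ⟨t, fun u hu => ?_⟩
    obtain ⟨s, rfl⟩ : ∃ s, u = s + t := ⟨u - t, (tsub_add_cancel_of_le hu).symm⟩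
    rw [hφ.pullback_add hadd s t]
    exact (ht _ _ _).trans_lt htε
  choose a ha using hlim
  refine ⟨a, x₀, fun t ω => ?_, ha⟩
  have h1 := ((hcont t ω).tendsto _).comp (ha ω)
  have h2 := (ha (θ t ω)).comp (tendsto_atTop_mono (fun s => le_self_add) tendsto_id :
    Tendsto (fun s : ℝ≥0 => s + t) atTop atTop)
  refine tendsto_nhds_unique h1 (h2.congr fun s => ?_)
  have h3 : θ (-((s + t : ℝ≥0) : ℝ)) (θ t ω) = θ (-(s : ℝ)) ω := by
    rw [hadd]
    congr 1
    push_cast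
    ring
  simp only [Function.comp]
  rw [h3, hφ.add s t, hadd, add_neg_cancel, hzero, id]

end Cocycle

/-! ### The random equation -/

section RandomEquation

variable {Ω : Type*} {N : ℕ} {θ : ℝ → Ω → Ω} {q : ℕ → Ω → ℝ} {c C : ℝ}

/-- The solution operator of the random equation on `ℝ^N`. -/
noncomputable def solutionMap (θ : ℝ → Ω → Ω) (N : ℕ) (q : ℕ → Ω → ℝ) (κ : ℝ) (t : ℝ≥0) (ω : Ω)
    (p : Fin N → ℝ) : Fin N → ℝ :=
  flow (fun s => generator N fun i => q i (θ s ω)) κ p t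

/-- The restriction of the solution operator to the probability simplex. -/
noncomputable def simplexCocycle
    (h : ∀ ω, AdmissibleRates N c C fun s i => q i (θ s ω)) (t : ℝ≥0) (ω : Ω)
    (p : Simplex N) : Simplex N :=
  ⟨solutionMap θ N q (diagShift c C) t ω p.1,
    fun i => le_trans (mul_nonneg (Real.exp_pos _).le (p.2.1 i))
      ((h ω).exp_mul_le_flow p.2.1 t.2 i),
    ((h ω).sum_flow p.1 t.2).trans p.2.2⟩

lemma isCocycle_simplexCocycle (h : ∀ ω, AdmissibleRates N c C fun s i => q i (θ s ω))
    (hadd : ∀ t s ω, θ t (θ s ω) = θ (t + s) ω) : IsCocycle θ (simplexCocycle h) where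
  zero ω x := Subtype.ext (by
    exact (((h ω).isIntegralSolution_flow x.1).eq 0 le_rfl).trans (by simp))
  add t s ω x := Subtype.ext (by
    have h1 := ((h ω).isIntegralSolution_flow x.1).shift
      (h ω).isBoundedMeasurable t.2
    have h2 := (h (θ t ω)).isIntegralSolution_flow (solutionMap θ N q (diagShift c C) t ω x.1)
    simp only [hadd, add_comm _ (t : ℝ)] at h2
    have hb := (h (θ t ω)).isBoundedMeasurable
    simp only [hadd, add_comm _ (t : ℝ)] at hb
    have := h1.unique hb h2 s.2
    simp only [simplexCocycle, solutionMap, NNReal.coe_add, hadd, add_comm _ (t : ℝ)]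
    exact this)

lemma measurable_solutionMap [MeasurableSpace Ω]
    (hθ : Measurable fun z : ℝ × Ω => θ z.1 z.2)
    (hq : ∀ i ∈ Finset.Icc 1 (2 * N - 2), Measurable (q i))
    (h : ∀ ω, AdmissibleRates N c C fun s i => q i (θ s ω)) (t : ℝ≥0) (p : Fin N → ℝ) :
    Measurable fun ω => solutionMap θ N q (diagShift c C) t ω p := by
  have hB : ∀ i j, Measurable fun z : Ω × ℝ =>
      (generator N (fun k => q k (θ z.2 z.1)) + diagShift c C • 1) i j := fun i j =>
    (measurable_generator (q := fun k (z : Ω × ℝ) => q k (θ z.2 z.1))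
      (fun k hk => (hq k hk).comp (hθ.comp measurable_swap)) i j).add_const _
  have hsum := measurable_picardSum hB (fun ω => (h ω).isBoundedMeasurable_shifted) p t.2
  exact hsum.const_smul (Real.exp (-diagShift c C * t))

end RandomEquation

end RandomMarkov

theorem theorem3 {Ω : Type*} [MeasurableSpace Ω] (P : Measure Ω) [IsProbabilityMeasure P]
    (θ : ℝ → Ω → Ω) (hθ : RandomMarkov.IsMetricDynamicalSystem P θ)
    (N : ℕ) (hN : 1 ≤ N) (q : ℕ → Ω → ℝ)
    (hqm : ∀ i ∈ Finset.Icc 1 (2 * N - 2), Measurable (q i))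
    (c C : ℝ) (hc : 0 < c)
    (hq : ∀ i ∈ Finset.Icc 1 (2 * N - 2), ∀ ω : Ω, c ≤ q i ω ∧ q i ω ≤ C) :
    -- the solution operator `φ` on `ℝ^N` and its restriction `ψ` to the probability simplex
    ∃ φ : ℝ≥0 → Ω → (Fin N → ℝ) → (Fin N → ℝ),
      RandomMarkov.IsSolutionOperator θ
        (fun ω => RandomMarkov.generator N (fun i => q i ω)) φ ∧
      ∃ ψ : ℝ≥0 → Ω → RandomMarkov.Simplex N → RandomMarkov.Simplex N,
        (∀ t ω p, (ψ t ω p : Fin N → ℝ) = φ t ω p) ∧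
        (∀ t ω, ∀ p ∈ RandomMarkov.openSimplex N, ψ t ω p ∈ RandomMarkov.openSimplex N) ∧
        RandomMarkov.IsCocycle θ ψ ∧
        RandomMarkov.UniformlyDissipative (M := RandomMarkov.HilbertSimplex N) ψ ∧
        RandomMarkov.UniformlyContractive (M := RandomMarkov.HilbertSimplex N) ψ ∧
        ∃ a : Ω → RandomMarkov.Simplex N,
          (∀ ω, a ω ∈ RandomMarkov.openSimplex N) ∧
          -- random attractor for the norm metric and for the Hilbert projective metric
          RandomMarkov.IsRandomAttractor θ ψ (fun ω => {a ω}) ∧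
          RandomMarkov.IsRandomAttractor (M := RandomMarkov.HilbertSimplex N) θ ψ
            (fun ω => {a ω}) ∧
          ∀ p ∈ RandomMarkov.openSimplex N, ∀ ω : Ω,
            Tendsto (fun t : ℝ≥0 => ‖φ t ω p - (a (θ t ω) : Fin N → ℝ)‖) atTop (𝓝 0) := by
  open RandomMarkov in
  have hadd : ∀ t s ω, θ t (θ s ω) = θ (t + s) ω := fun t s ω => congrFun (hθ.comp t s) ω
  have hrates : ∀ ω, AdmissibleRates N c C fun s i => q i (θ s ω) := fun ω =>
    ⟨hc, fun i hi => (hqm i hi).comp (hθ.measurable.comp (measurable_id.prodMk measurable_const)),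
      fun t i hi => hq i hi _⟩
  set δ := mixingRate N c C
  have hδ0 : 0 < δ := mixingRate_pos hN hc C
  have hδ1 : δ < 1 := mixingRate_lt_one N c C
  set ψ := simplexCocycle hrates
  have hcocycle : IsCocycle θ ψ := isCocycle_simplexCocycle hrates hadd
  -- the time-one maps have images in a compact part of the open simplex and are contractions
  have hlow : ∀ ω x i, δ ≤ (ψ 1 ω x).1 i := by
    intro ω x i
    have := (hrates ω).mixingRate_mul_sum_le_flow x.2.1 i
    rwa [x.2.2, mul_one] at this
  set R := Real.log (δ⁻¹ * δ⁻¹)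
  have hR0 : 0 ≤ R := Real.log_nonneg
    (one_le_mul_of_one_le_of_one_le ((one_le_inv₀ hδ0).2 hδ1.le) ((one_le_inv₀ hδ0).2 hδ1.le))
  have hbdd : ∀ ω x y, edist (α := HilbertSimplex N) (ψ 1 ω x) (ψ 1 ω y) ≤ ENNReal.ofReal R :=
    fun ω x y => HilbertSimplex.edist_le_of_le_coord hδ0 (hlow ω x) (hlow ω y)
  have hcontr : ∀ ω (x y : HilbertSimplex N), edist (α := HilbertSimplex N) (ψ 1 ω x) (ψ 1 ω y)
      ≤ (1 - δ).toNNReal * edist x y := fun ω x y =>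
    HilbertSimplex.edist_map_le (F := (hrates ω).flowMap zero_le_one) hδ0 hδ1
      (fun v hv i => (hrates ω).mixingRate_mul_sum_le_flow hv i) rfl rfl
  have hlam : (1 - δ).toNNReal < 1 := by
    rw [Real.toNNReal_lt_one]
    linarith
  -- exponential rates for the Hilbert metric and for the norm
  set b : ℝ≥0 → ℝ := fun t => (1 - δ) ^ (⌊t⌋₊ - 1) * R with hb
  have hb0 : ∀ t, 0 ≤ b t := fun t => mul_nonneg (pow_nonneg (by linarith) _) hR0
  have hblim : Tendsto b atTop (𝓝 0) := by
    have h1 := tendsto_pow_atTop_nhds_zero_of_lt_one (r := 1 - δ) (by linarith) (by linarith)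
    have h2 := (h1.comp ((tendsto_sub_atTop_nat 1).comp
      (tendsto_nat_floor_atTop (α := ℝ≥0)))).mul_const R
    rwa [zero_mul] at h2
  have hHilbert : ∀ᶠ t : ℝ≥0 in atTop, ∀ ω x y,
      edist (α := HilbertSimplex N) (ψ t ω x) (ψ t ω y) ≤ ENNReal.ofReal (b t) := by
    filter_upwards [eventually_ge_atTop 1] with t ht ω x y
    have hfl : 1 ≤ ⌊t⌋₊ := Nat.one_le_floor_iff t |>.2 ht
    have h1 := IsCocycle.edist_le_pow (M := HilbertSimplex N) (φ := ψ)
      ⟨hcocycle.zero, hcocycle.add⟩ hcontr hbdd (⌊t⌋₊ - 1) t (by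
        rw [← Nat.cast_add_one, Nat.sub_add_cancel hfl]
        exact Nat.floor_le zero_le) ω x y
    refine h1.trans_eq ?_
    rw [hb, ENNReal.ofReal_mul (pow_nonneg (by linarith) _), ENNReal.ofReal_pow (by linarith)]
    rfl
  have hnorm : ∀ᶠ t : ℝ≥0 in atTop, ∀ ω x y,
      dist (ψ t ω x) (ψ t ω y) ≤ Real.exp (b t) - 1 := by
    filter_upwards [hHilbert] with t ht ω x y
    exact HilbertSimplex.dist_le_exp_sub_one (hb0 t) (ht ω x y)
  have hexp : Tendsto (fun t => Real.exp (b t) - 1) atTop (𝓝 0) := by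
    have := ((Real.continuous_exp.tendsto 0).comp hblim).sub_const 1
    rwa [Real.exp_zero, sub_self] at this
  have hcont : ∀ t ω, Continuous (ψ t ω) := fun t ω =>
    (((hrates ω).flowMap t.2).continuous_of_finiteDimensional.comp
      continuous_subtype_val).subtype_mk _
  have : Nonempty (Fin N) := ⟨⟨0, hN⟩⟩
  obtain ⟨a, x₀, hinv, hlim⟩ :=
    hcocycle.exists_invariant_point hθ.zero hadd hcont hexp hnorm
  have hopen : ∀ ω, a ω ∈ openSimplex N := by
    intro ω i
    have h1 := hinv 1 (θ (-((1 : ℝ≥0) : ℝ)) ω)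
    rw [hadd, add_neg_cancel, hθ.zero, id] at h1
    rw [← h1]
    exact hδ0.trans_le (hlow _ _ i)
  have hmeas : Measurable a := by
    refine measurable_of_tendsto_metrizable (f := fun (n : ℕ) ω =>
      ψ n (θ (-((n : ℝ≥0) : ℝ)) ω) x₀) (fun n => Measurable.subtype_mk ?_)
      (tendsto_pi_nhds.2 fun ω => (hlim ω).comp tendsto_natCast_atTop_atTop)
    have h1 := measurable_solutionMap hθ.measurable hqm hrates n x₀.1
    exact h1.comp (hθ.measurable.comp
      (measurable_const.prodMk measurable_id : Measurable fun ω : Ω => (-((n : ℝ≥0) : ℝ), ω)))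
  refine ⟨solutionMap θ N q (diagShift c C), fun ω p x => ?_, ψ, fun _ _ _ => rfl,
    fun t ω p hp i => ?_, hcocycle, ?_, ⟨1, _, hlam, hcontr⟩, a, hopen, ?_, ?_, ?_⟩
  · rw [(hrates ω).isSolution_iff]
    exact ⟨fun h t => h t t.2, fun h t ht => h ⟨t, ht⟩⟩
  · exact (mul_pos (Real.exp_pos _) (hp i)).trans_le
      ((hrates ω).exp_mul_le_flow p.2.1 t.2 i)
  · have hdiam : Metric.ediam (X := HilbertSimplex N) (⋃ ω, ψ 1 ω '' univ)
        ≤ ENNReal.ofReal R := by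
      refine Metric.ediam_le fun y hy z hz => ?_
      obtain ⟨ω, x, -, rfl⟩ := mem_iUnion.1 hy
      obtain ⟨ω', x', -, rfl⟩ := mem_iUnion.1 hz
      exact HilbertSimplex.edist_le_of_le_coord hδ0 (hlow ω x) (hlow ω' x')
    refine ⟨1, closure (X := HilbertSimplex N) (⋃ ω, ψ 1 ω '' univ),
      isClosed_closure (X := HilbertSimplex N), ?_,
      fun ω => (subset_iUnion (fun ω => ψ 1 ω '' univ) ω).trans
        (subset_closure (X := HilbertSimplex N))⟩
    rw [Metric.ediam_closure]
    exact ne_top_of_le_ne_top ENNReal.ofReal_ne_top hdiam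
  · refine isRandomAttractor_singleton hθ.zero hadd (fun U hU => ?_) hinv
      (b := fun t => ENNReal.ofReal (Real.exp (b t) - 1)) ?_ ?_
    · have hU : IsOpen (X := Simplex N) U := hU
      exact hmeas hU.measurableSet
    · simpa using ENNReal.tendsto_ofReal hexp
    · filter_upwards [hnorm] with t ht ω x y
      rw [edist_dist]
      exact ENNReal.ofReal_le_ofReal (ht ω x y)
  · refine isRandomAttractor_singleton (M := HilbertSimplex N) hθ.zero hadd (fun U hU => ?_) hinv
      (b := fun t => ENNReal.ofReal (b t)) ?_ hHilbert
    · have := hmeas (HilbertSimplex.isOpen_openSimplex_inter hU).measurableSet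
      convert this using 1
      ext ω
      exact ⟨fun h => ⟨hopen ω, h⟩, fun h => h.2⟩
    · simpa using ENNReal.tendsto_ofReal hblim
  · intro p hp ω
    refine squeeze_zero' (Eventually.of_forall fun _ => norm_nonneg _) ?_ hexp
    filter_upwards [hnorm] with t ht
    have := ht ω p (a ω)
    rw [hinv, Subtype.dist_eq, dist_eq_norm] at this
    exact this
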